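/- All graphs are finite and simple. The join $G\vee A$ of two vertex-disjoint graphs is their disjoint union together with all edges between $V(G)$ and $V(A)$. A cover of a graph $F$ is a pair $(L,H)$, where $H$ is a graph and $L$ assigns to each $u\in V(F)$ a set $L(u)\subseteq V(H)$, such that the sets $L(u)$, $u\in V(F)$, partition $V(H)$; each $L(u)$ induces a complete subgraph of $H$; there are no edges of $H$ between $L(u)$ and $L(v)$ if $u\neq v$ are not adjacent in $F$; and for each edge $uv$ of $F$ the edges of $H$ between $L(u)$ and $L(v)$ form a (possibly empty) matching. The graph $F$ is $(L,H)$-colorable if $H$ has an independent set of size $|V(F)|$. **Theorem.** Let $G$ be a $k$-colorable graph, let $A$ be a complete graph with $|A|$ vertices, and let $(L,H)$ be a cover of $G\vee A$ such that $|L(a)|\ge |A|+\chi(G)$ for every $a\in V(A)$ and $$|A|\ \ge\ \frac{2(k+1)}{2k+1}\sum_{v\in V(G)}\max\{d_G(v)-|L(v)|+|A|+k,\,0\}.$$ Then $G\vee A$ is $(L,H)$-colorable. -/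

import Mathlib

open scoped SimpleGraph

/-- The join `G ∨ B` of two vertex-disjoint graphs: the disjoint union of `G` and `B`, together with
all edges between a vertex of `G` and a vertex of `B`. -/
def graphJoin {V α : Type*} (G : SimpleGraph V) (B : SimpleGraph α) : SimpleGraph (V ⊕ α) :=
  (G ⊕g B) ⊔ completeBipartiteGraph V α

/-- `(L, H)` is a cover of the graph `G`, where `H` is a graph on the vertex type `W` and `L`
assigns to every vertex of `G` a finite set of vertices of `H`. -/
structure IsDPCover {V W : Type*} (G : SimpleGraph V) (L : V → Finset W) (H : SimpleGraph W) :
    Prop where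
  /-- The sets `L u` partition the vertex set of `H`. -/
  partition : ∀ x : W, ∃! u : V, x ∈ L u
  /-- The subgraph of `H` induced on `L u` is complete. -/
  complete : ∀ u : V, H.IsClique (L u : Set W)
  /-- There are no edges between the lists of distinct non-adjacent vertices. -/
  no_edges : ∀ u v : V, u ≠ v → ¬ G.Adj u v → ∀ x ∈ L u, ∀ y ∈ L v, ¬ H.Adj x y
  /-- If `u v` is an edge of `G`, then the edges between `L u` and `L v` form a (possibly empty)
  matching: a vertex of `L u` has at most one neighbour in `L v` (and, as the condition is imposed
  on all ordered pairs, vice versa). -/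
  matching : ∀ u v : V, G.Adj u v → ∀ x ∈ L u, ∀ y ∈ L v, ∀ z ∈ L v,
    H.Adj x y → H.Adj x z → y = z

/-- For a cover `(L, H)` of a graph on the vertex set `V`: the graph is `(L, H)`-colorable if `H` has
an independent set of size `|V|`. -/
def IsDPColorable (V : Type*) [Fintype V] {W : Type*} (H : SimpleGraph W) : Prop :=
  ∃ I : Finset W, H.IsIndepSet (I : Set W) ∧ I.card = Fintype.card V

/-! Induct on the number of uncolored vertices, with the total `cost` on `P` bounded by the budget
`|B|`. Coloring `T ⊆ B` takes `|T|` from the budget, while the excess of `v` falls by its saving: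
`|T|` minus the number of elements killed in the list of `v`. A set `T` whose savings sum to `|T|`
therefore reduces the problem, provided no saving exceeds the excess by more than one.

In a minimal counterexample all excesses are nonnegative, and each color on `B` has a neighbor in
every list on `P`. Grow `T` from a single vertex, always adding a color adjacent to an element
already killed. The savings then sum to at least `|T| - 1`. A collision in a second list, or a
saving above the excess, supplies the missing unit at once (`extend_compressed`).

If `T` cannot grow, the unit comes from a color class of `G` (`color_class`). The color of the last
vertex `b` meets earlier kills in at most one list, that of some `v`. Take a neighbor `w` of `v`,
uncolor `b`, and give each vertex in the class of `w` the neighbor of `b`'s old color. The class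
avoids `v`, so it is compatible with the rest of `T`. Its removal frees one class color for the
lists on `B` and at least one unit of cost.

Only `∑ max ≤ |A|` is needed: the factor in the theorem is at least 1. -/

/-- The elements of the list of `j` that are adjacent to a color `s i` with `i ∈ Q`. -/
noncomputable def killed {I W : Type*} (H : SimpleGraph W) (M : I → Finset W) (s : I → W)
    (Q : Finset I) (j : I) : Finset W := by
  classical exact (M j).filter fun x => ∃ i ∈ Q, H.Adj (s i) x

/-- The vertices in `Q` can be given pairwise non-adjacent colors from their lists. -/
def HasTransversal {I W : Type*} (H : SimpleGraph W) (M : I → Finset W) (Q : Finset I) : Prop :=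
  ∃ s : I → W, (∀ i ∈ Q, s i ∈ M i) ∧ ∀ i ∈ Q, ∀ j ∈ Q, i ≠ j → ¬ H.Adj (s i) (s j)

/-- The degree of `v` in the join of the graph induced on `P` with a complete graph on `B`, minus
the size of its list. -/
noncomputable def excess {I W : Type*} (F : SimpleGraph I) (M : I → Finset W) (P B : Finset I)
    (v : I) : ℤ := by
  classical exact ((P.filter (F.Adj v)).card : ℤ) + (B.card : ℤ) - ((M v).card : ℤ)

/-- The contribution of a vertex of given excess to the sum that the complete part must dominate. -/
def cost (k : ℕ) (e : ℤ) : ℤ := if 0 ≤ e then e + k else 0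

/-- A partial coloring problem: the uncolored vertices are `P ∪ B`, where `B` is the part coming
from the complete graph, `C` is a proper coloring on `P`, and `M` are the remaining lists. -/
structure IsAdmissible {I W : Type*} [DecidableEq I] (F : SimpleGraph I) (H : SimpleGraph W)
    (C : I → ℕ) (k : ℕ) (P B : Finset I) (M : I → Finset W) : Prop where
  disj : Disjoint P B
  matching : ∀ i j, i ≠ j → ∀ x ∈ M i, ∀ y ∈ M j, ∀ z ∈ M j, H.Adj x y → H.Adj x z → y = z
  no_edges : ∀ u ∈ P, ∀ v ∈ P, u ≠ v → ¬ F.Adj u v → ∀ x ∈ M u, ∀ y ∈ M v, ¬ H.Adj x y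
  proper : ∀ u ∈ P, ∀ v ∈ P, F.Adj u v → C u ≠ C v
  colors_le : (P.image C).card ≤ k
  large : ∀ a ∈ B, B.card + (P.image C).card ≤ (M a).card
  cost_le : ∑ v ∈ P, cost k (excess F M P B v) ≤ B.card

/-! ### Elements killed by a partial coloring -/

section
variable {I W : Type*}

theorem mem_killed {H : SimpleGraph W} {M : I → Finset W} {s : I → W} {Q : Finset I} {j : I}
    {x : W} : x ∈ killed H M s Q j ↔ x ∈ M j ∧ ∃ i ∈ Q, H.Adj (s i) x := by
  classical
  simp [killed]

theorem killed_subset {H : SimpleGraph W} {M : I → Finset W} {s : I → W} {Q : Finset I} {j : I} :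
    killed H M s Q j ⊆ M j := fun _ hx => (mem_killed.1 hx).1

theorem killed_congr {H : SimpleGraph W} {M : I → Finset W} {s s' : I → W} {Q : Finset I} {j : I}
    (h : ∀ i ∈ Q, s i = s' i) : killed H M s Q j = killed H M s' Q j := by
  ext x
  simp only [mem_killed]
  refine and_congr_right fun _ => exists_congr fun i => and_congr_right fun hi => ?_
  rw [h i hi]

theorem killed_mono {H : SimpleGraph W} {M : I → Finset W} {s : I → W} {Q Q' : Finset I} {j : I}
    (h : Q ⊆ Q') : killed H M s Q j ⊆ killed H M s Q' j := by
  intro x hx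
  obtain ⟨hx, i, hi, hix⟩ := mem_killed.1 hx
  exact mem_killed.2 ⟨hx, i, h hi, hix⟩

/-- By the matching condition each colored vertex kills at most one element of a given other list.
-/
theorem card_killed_le {H : SimpleGraph W} {M : I → Finset W}
    (hM : ∀ i j, i ≠ j → ∀ x ∈ M i, ∀ y ∈ M j, ∀ z ∈ M j, H.Adj x y → H.Adj x z → y = z)
    {s : I → W} {Q : Finset I} {j : I} (hs : ∀ i ∈ Q, s i ∈ M i) (hj : j ∉ Q) :
    (killed H M s Q j).card ≤ Q.card := by
  classical
  have h : killed H M s Q j ⊆ Q.biUnion fun i => (M j).filter fun x => H.Adj (s i) x := by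
    intro x hx
    obtain ⟨hx, i, hi, hix⟩ := mem_killed.1 hx
    exact Finset.mem_biUnion.2 ⟨i, hi, Finset.mem_filter.2 ⟨hx, hix⟩⟩
  refine (Finset.card_le_card h).trans ?_
  refine (Finset.card_biUnion_le_card_mul _ _ 1 fun i hi => ?_).trans (by simp)
  refine Finset.card_le_one.2 fun y hy z hz => ?_
  rw [Finset.mem_filter] at hy hz
  exact hM i j (fun h => hj (h ▸ hi)) _ (hs i hi) _ hy.1 _ hz.1 hy.2 hz.2

theorem killed_union_subset [DecidableEq I] [DecidableEq W] {H : SimpleGraph W}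
    {M : I → Finset W} {s : I → W} {Q Q' : Finset I} {j : I} :
    killed H M s (Q ∪ Q') j ⊆ killed H M s Q j ∪ killed H M s Q' j := by
  intro x hx
  obtain ⟨hx, i, hi, hix⟩ := mem_killed.1 hx
  rcases Finset.mem_union.1 hi with hi | hi
  · exact Finset.mem_union_left _ (mem_killed.2 ⟨hx, i, hi, hix⟩)
  · exact Finset.mem_union_right _ (mem_killed.2 ⟨hx, i, hi, hix⟩)

/-- Coloring one more vertex of the complete part kills at most one more element of a list. -/
theorem card_killed_insert_le [DecidableEq I] {H : SimpleGraph W} {M : I → Finset W}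
    (hM : ∀ i j, i ≠ j → ∀ x ∈ M i, ∀ y ∈ M j, ∀ z ∈ M j, H.Adj x y → H.Adj x z → y = z)
    {s : I → W} {Q : Finset I} {a j : I} (ha : s a ∈ M a) (hj : j ≠ a) :
    (killed H M s (insert a Q) j).card ≤ (killed H M s Q j).card + 1 := by
  classical
  rw [Finset.insert_eq, Finset.union_comm]
  refine (Finset.card_le_card killed_union_subset).trans ((Finset.card_union_le _ _).trans ?_)
  have := card_killed_le hM (s := s) (Q := {a}) (j := j) (by simpa using ha) (by simpa using hj)
  simpa using this

/-- If the new color is adjacent to a killed element, then no further element is killed. -/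
theorem killed_insert_eq [DecidableEq I] {H : SimpleGraph W} {M : I → Finset W}
    (hM : ∀ i j, i ≠ j → ∀ x ∈ M i, ∀ y ∈ M j, ∀ z ∈ M j, H.Adj x y → H.Adj x z → y = z)
    {s : I → W} {Q : Finset I} {a j : I} (ha : s a ∈ M a) (hj : j ≠ a) {x : W}
    (hx : x ∈ killed H M s Q j) (hax : H.Adj (s a) x) :
    killed H M s (insert a Q) j = killed H M s Q j := by
  refine (Finset.Subset.antisymm (killed_mono (Finset.subset_insert _ _)) ?_).symm
  intro z hz
  obtain ⟨hzM, i, hi, hiz⟩ := mem_killed.1 hz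
  rcases Finset.mem_insert.1 hi with rfl | hi
  · rwa [← hM i j hj.symm _ ha _ (killed_subset hx) _ hzM hax hiz]
  · exact mem_killed.2 ⟨hzM, i, hi, hiz⟩

/-- A partial coloring and a coloring of the rest from the surviving colors fit together. -/
theorem HasTransversal.extend [DecidableEq I] [DecidableEq W] {H : SimpleGraph W}
    {M : I → Finset W} {s : I → W} {Q R : Finset I} (hs : ∀ i ∈ Q, s i ∈ M i)
    (hind : ∀ i ∈ Q, ∀ j ∈ Q, i ≠ j → ¬ H.Adj (s i) (s j))
    (h : HasTransversal H (fun j => M j \ killed H M s Q j) R) :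
    HasTransversal H M (Q ∪ R) := by
  obtain ⟨r, hr, hr'⟩ := h
  have hcross : ∀ i ∈ Q, ∀ j ∈ R, ¬ H.Adj (s i) (r j) := by
    intro i hi j hj hadj
    have := Finset.mem_sdiff.1 (hr j hj)
    exact this.2 (mem_killed.2 ⟨this.1, i, hi, hadj⟩)
  refine ⟨fun i => if i ∈ Q then s i else r i, fun i hi => ?_, fun i hi j hj hij => ?_⟩
  · by_cases hiQ : i ∈ Q
    · simpa [hiQ] using hs i hiQ
    · have : i ∈ R := (Finset.mem_union.1 hi).resolve_left hiQ
      simpa [hiQ] using (Finset.mem_sdiff.1 (hr i this)).1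
  · by_cases hiQ : i ∈ Q <;> by_cases hjQ : j ∈ Q <;> simp only [hiQ, hjQ, if_true, if_false]
    · exact hind i hiQ j hjQ hij
    · exact hcross i hiQ j ((Finset.mem_union.1 hj).resolve_left hjQ)
    · exact fun h => hcross j hjQ i ((Finset.mem_union.1 hi).resolve_left hiQ) h.symm
    · exact hr' i ((Finset.mem_union.1 hi).resolve_left hiQ) j
        ((Finset.mem_union.1 hj).resolve_left hjQ) hij

/-! ### Arithmetic of the cost -/

theorem cost_nonneg (k : ℕ) (e : ℤ) : 0 ≤ cost k e := by
  unfold cost; split_ifs <;> positivity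

theorem cost_mono (k : ℕ) : Monotone (cost k) := by
  intro e e' h
  unfold cost; split_ifs <;> omega

theorem cost_of_nonneg (k : ℕ) {e : ℤ} (h : 0 ≤ e) : cost k e = e + k := if_pos h

theorem cost_of_neg (k : ℕ) {e : ℤ} (h : e < 0) : cost k e = 0 := if_neg (by omega)

/-- The boundary case is `c = e + 1`: the cost falls from `e + k` to 0, a drop of `c + (k - 1)`. -/
theorem cost_sub_le {k : ℕ} (hk : 1 ≤ k) {e c : ℤ} (he : 0 ≤ e) (hc : c ≤ e + 1) :
    cost k (e - c) ≤ cost k e - c := by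
  unfold cost; split_ifs <;> omega

theorem IsAdmissible.notMem_right [DecidableEq I] {F : SimpleGraph I} {H : SimpleGraph W}
    {C : I → ℕ} {k : ℕ} {P B : Finset I} {M : I → Finset W} (h : IsAdmissible F H C k P B M) {v : I}
    (hv : v ∈ P) : v ∉ B :=
  Finset.disjoint_left.1 h.disj hv

/-! ### Basic reductions of an admissible problem -/

namespace IsAdmissible
variable [DecidableEq I] [DecidableEq W] {F : SimpleGraph I} {H : SimpleGraph W} {C : I → ℕ}
  {k : ℕ} {P B : Finset I} {M : I → Finset W}

/-- The problem that remains after coloring vertices in `U ⊆ P` and `T ⊆ B`. -/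
theorem sdiff (h : IsAdmissible F H C k P B M) {s : I → W} {U T : Finset I}
    (hlarge : ∀ a ∈ B \ T, (B \ T).card + ((P \ U).image C).card + (killed H M s (U ∪ T) a).card ≤
      (M a).card)
    (hcost : ∑ v ∈ P \ U, cost k (excess F (fun j => M j \ killed H M s (U ∪ T) j) (P \ U) (B \ T) v)
      ≤ (B \ T).card) :
    IsAdmissible F H C k (P \ U) (B \ T) (fun j => M j \ killed H M s (U ∪ T) j) where
  disj := h.disj.mono Finset.sdiff_subset Finset.sdiff_subset
  matching i j hij x hx y hy z hz := h.matching i j hij x (Finset.sdiff_subset hx)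
    y (Finset.sdiff_subset hy) z (Finset.sdiff_subset hz)
  no_edges u hu v hv huv hF x hx y hy := h.no_edges u (Finset.sdiff_subset hu)
    v (Finset.sdiff_subset hv) huv hF x (Finset.sdiff_subset hx) y (Finset.sdiff_subset hy)
  proper u hu v hv := h.proper u (Finset.sdiff_subset hu) v (Finset.sdiff_subset hv)
  colors_le := (Finset.card_le_card (Finset.image_subset_image Finset.sdiff_subset)).trans
    h.colors_le
  large a ha := by
    have := hlarge a ha
    rw [Finset.card_sdiff_of_subset killed_subset]
    omega
  cost_le := hcost

/-- Reduction by coloring a set `T` of vertices of the complete part. -/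
theorem color_right (h : IsAdmissible F H C k P B M)
    (IH : ∀ P' B' M', P'.card + B'.card < P.card + B.card → IsAdmissible F H C k P' B' M' →
      HasTransversal H M' (P' ∪ B'))
    {s : I → W} {T : Finset I} (hTB : T ⊆ B) (hT : T.Nonempty) (hs : ∀ a ∈ T, s a ∈ M a)
    (hind : ∀ i ∈ T, ∀ j ∈ T, i ≠ j → ¬ H.Adj (s i) (s j))
    (hcost : ∑ v ∈ P, cost k (excess F M P B v - (T.card - (killed H M s T v).card)) ≤
      (B.card : ℤ) - T.card) :
    HasTransversal H M (P ∪ B) := by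
  have hcard : (B \ T).card + T.card = B.card := Finset.card_sdiff_add_card_eq_card hTB
  have hTpos := hT.card_pos
  have key := h.sdiff (s := s) (U := ∅) (T := T) (fun a ha => ?_) ?_
  · simp only [Finset.sdiff_empty, Finset.empty_union] at key
    have := HasTransversal.extend hs hind (IH _ _ _ (by omega) key)
    refine (?_ : T ∪ (P ∪ B \ T) = P ∪ B) ▸ this
    rw [← Finset.union_assoc, Finset.union_comm T P, Finset.union_assoc,
      Finset.union_sdiff_of_subset hTB]
  · simp only [Finset.sdiff_empty, Finset.empty_union]
    rw [Finset.mem_sdiff] at ha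
    -- `|B|` drops by `|T|`, and at most `|T|` elements of the list of `a` are killed.
    have h1 := h.large a ha.1
    have h2 := card_killed_le h.matching hs ha.2
    omega
  · simp only [Finset.sdiff_empty, Finset.empty_union]
    have : ((B \ T).card : ℤ) = B.card - T.card := by omega
    rw [this]
    refine le_trans (le_of_eq (Finset.sum_congr rfl fun v _ => ?_)) hcost
    congr 1
    simp only [excess]
    rw [Finset.card_sdiff_of_subset killed_subset, this,
      Nat.cast_sub (Finset.card_le_card killed_subset)]
    ring

theorem of_left_empty (h : IsAdmissible F H C k ∅ B M)
    (IH : ∀ P' B' M', P'.card + B'.card < (∅ : Finset I).card + B.card →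
      IsAdmissible F H C k P' B' M' → HasTransversal H M' (P' ∪ B')) (hW : Nonempty W) :
    HasTransversal H M (∅ ∪ B) := by
  rcases B.eq_empty_or_nonempty with rfl | ⟨a, ha⟩
  · exact ⟨fun _ => hW.some, by simp, by simp⟩
  · have h1 := h.large a ha
    have hB : 0 < B.card := Finset.card_pos.2 ⟨a, ha⟩
    obtain ⟨y, hy⟩ : (M a).Nonempty := Finset.card_pos.1 (by omega)
    refine h.color_right IH (s := fun _ => y) (T := {a}) (by simpa using ha) (by simp)
      (by simpa using hy) (by simp) ?_
    simp only [Finset.sum_empty, Finset.card_singleton]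
    omega

/-- Reduction by deleting a vertex whose list exceeds its degree. -/
theorem delete_left (h : IsAdmissible F H C k P B M)
    (IH : ∀ P' B' M', P'.card + B'.card < P.card + B.card → IsAdmissible F H C k P' B' M' →
      HasTransversal H M' (P' ∪ B'))
    {v : I} (hv : v ∈ P) (hneg : excess F M P B v < 0) : HasTransversal H M (P ∪ B) := by
  classical
  have hlt := Finset.card_erase_lt_of_mem hv
  have key : IsAdmissible F H C k (P.erase v) B M :=
    { disj := h.disj.mono_left (Finset.erase_subset _ _)
      matching := h.matching
      no_edges := fun u hu w hw => h.no_edges u (Finset.mem_of_mem_erase hu) w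
        (Finset.mem_of_mem_erase hw)
      proper := fun u hu w hw => h.proper u (Finset.mem_of_mem_erase hu) w
        (Finset.mem_of_mem_erase hw)
      colors_le := (Finset.card_le_card (Finset.image_subset_image (Finset.erase_subset _ _))).trans
        h.colors_le
      large := fun a ha => (Nat.add_le_add_left (Finset.card_le_card
        (Finset.image_subset_image (Finset.erase_subset _ _))) _).trans (h.large a ha)
      cost_le := by
        refine le_trans ?_ h.cost_le
        refine le_trans ?_ (Finset.sum_le_sum_of_subset_of_nonneg (Finset.erase_subset v P)
          fun _ _ _ => cost_nonneg _ _)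
        refine Finset.sum_le_sum fun u _ => cost_mono k ?_
        have := Finset.card_le_card (Finset.filter_subset_filter (F.Adj u) (Finset.erase_subset v P))
        simp only [excess]
        omega }
  obtain ⟨s, hs, hs'⟩ := IH _ _ _ (by omega) key
  set Q := P.filter (F.Adj v) ∪ B with hQ
  have hvB := h.notMem_right hv
  have hQsub : Q ⊆ P.erase v ∪ B := by
    refine Finset.union_subset_union_left fun u hu => ?_
    rw [Finset.mem_filter] at hu
    exact Finset.mem_erase.2 ⟨fun e => F.loopless.irrefl v (e ▸ hu.2), hu.1⟩
  have hvR : v ∉ P.erase v ∪ B := by simp [hvB]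
  have h1 := card_killed_le h.matching (s := s) (Q := Q) (j := v) (fun i hi => hs i (hQsub hi))
    (fun hv => hvR (hQsub hv))
  have h2 : Q.card ≤ _ := Finset.card_union_le _ _
  obtain ⟨x, hx, hxk⟩ : ∃ x ∈ M v, x ∉ killed H M s Q v := by
    by_contra! hcon
    have := Finset.card_le_card (show M v ⊆ killed H M s Q v from hcon)
    simp only [excess] at hneg
    omega
  have hxs : ∀ i ∈ P.erase v ∪ B, ¬ H.Adj (s i) x := by
    intro i hi hadj
    by_cases hiQ : i ∈ Q
    · exact hxk (mem_killed.2 ⟨hx, i, hiQ, hadj⟩)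
    · rcases Finset.mem_union.1 hi with hi' | hi'
      · refine h.no_edges i (Finset.mem_of_mem_erase hi') v hv (Finset.ne_of_mem_erase hi')
          (fun hF => hiQ ?_) _ (hs i hi) _ hx hadj
        exact Finset.mem_union_left _
          (Finset.mem_filter.2 ⟨Finset.mem_of_mem_erase hi', hF.symm⟩)
      · exact hiQ (Finset.mem_union_right _ hi')
  have hmem : ∀ i ∈ P ∪ B, i ≠ v → i ∈ P.erase v ∪ B := by
    intro i hi hiv
    simpa [hiv] using hi
  refine ⟨Function.update s v x, fun i hi => ?_, fun i hi j hj hij => ?_⟩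
  · by_cases hiv : i = v
    · subst hiv; simpa using hx
    · simpa [hiv] using hs i (hmem i hi hiv)
  · by_cases hiv : i = v
    · subst hiv
      simpa [Ne.symm hij] using fun e => hxs j (hmem j hj (Ne.symm hij)) (H.adj_symm e)
    · by_cases hjv : j = v
      · subst hjv
        simpa [hij] using hxs i (hmem i hi hij)
      · simpa [hiv, hjv] using hs' i (hmem i hi hiv) j (hmem j hj hjv) hij

end IsAdmissible
end

/-! ### Reductions by savings and by a color class -/

section
variable {I W : Type*}
namespace IsAdmissible
variable [DecidableEq I] [DecidableEq W] {F : SimpleGraph I} {H : SimpleGraph W} {C : I → ℕ}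
  {k : ℕ} {P B : Finset I} {M : I → Finset W}

theorem color_right_of_collisions (h : IsAdmissible F H C k P B M)
    (IH : ∀ P' B' M', P'.card + B'.card < P.card + B.card → IsAdmissible F H C k P' B' M' →
      HasTransversal H M' (P' ∪ B'))
    (hk : 1 ≤ k) (hexc : ∀ v ∈ P, 0 ≤ excess F M P B v)
    {s : I → W} {T : Finset I} (hTB : T ⊆ B) (hT : T.Nonempty) (hs : ∀ a ∈ T, s a ∈ M a)
    (hind : ∀ i ∈ T, ∀ j ∈ T, i ≠ j → ¬ H.Adj (s i) (s j))
    (hle : ∀ v ∈ P, (T.card : ℤ) - (killed H M s T v).card ≤ excess F M P B v + 1)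
    (hsum : (T.card : ℤ) ≤ ∑ v ∈ P, ((T.card : ℤ) - (killed H M s T v).card)) :
    HasTransversal H M (P ∪ B) := by
  refine h.color_right IH hTB hT hs hind ?_
  have h1 := Finset.sum_le_sum fun v hv => cost_sub_le hk (hexc v hv) (hle v hv)
  rw [Finset.sum_sub_distrib] at h1
  have := h.cost_le
  linarith

/-- A saving that makes the excess of `v` negative erases its whole cost, which exceeds the saving
by `k - 1 ≥ 1`. This makes up for the unit missing from `hsum`. -/
theorem color_right_of_overflow (h : IsAdmissible F H C k P B M)
    (IH : ∀ P' B' M', P'.card + B'.card < P.card + B.card → IsAdmissible F H C k P' B' M' →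
      HasTransversal H M' (P' ∪ B'))
    (hk : 2 ≤ k) (hexc : ∀ v ∈ P, 0 ≤ excess F M P B v)
    {s : I → W} {T : Finset I} (hTB : T ⊆ B) (hT : T.Nonempty) (hs : ∀ a ∈ T, s a ∈ M a)
    (hind : ∀ i ∈ T, ∀ j ∈ T, i ≠ j → ¬ H.Adj (s i) (s j))
    (hle : ∀ v ∈ P, (T.card : ℤ) - (killed H M s T v).card ≤ excess F M P B v + 1)
    (hsum : (T.card : ℤ) - 1 ≤ ∑ v ∈ P, ((T.card : ℤ) - (killed H M s T v).card))
    {v : I} (hv : v ∈ P) (hover : excess F M P B v < (T.card : ℤ) - (killed H M s T v).card) :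
    HasTransversal H M (P ∪ B) := by
  refine h.color_right IH hTB hT hs hind ?_
  have h1 := Finset.sum_lt_sum (fun v hv => cost_sub_le (k := k) (by omega) (hexc v hv) (hle v hv))
    ⟨v, hv, ?_⟩
  · rw [Finset.sum_sub_distrib] at h1
    have := h.cost_le
    linarith
  · have := hle v hv
    rw [cost_of_neg _ (by omega), cost_of_nonneg _ (hexc v hv)]
    omega

/-- Reduction by coloring the color class of `w` with neighbors of the color of `b`, together with
the vertices of `T` other than `b`. -/
theorem color_class (h : IsAdmissible F H C k P B M)
    (IH : ∀ P' B' M', P'.card + B'.card < P.card + B.card → IsAdmissible F H C k P' B' M' →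
      HasTransversal H M' (P' ∪ B'))
    (hk : 1 ≤ k) (hexc : ∀ v ∈ P, 0 ≤ excess F M P B v)
    (hnbr : ∀ u ∈ P, ∀ a ∈ B, ∀ y ∈ M a, ∃ x ∈ M u, H.Adj y x)
    {t : I → W} {T : Finset I} {b v w : I} (hTB : T ⊆ B) (hbT : b ∈ T) (ht : ∀ a ∈ T, t a ∈ M a)
    (hind : ∀ i ∈ T, ∀ j ∈ T, i ≠ j → ¬ H.Adj (t i) (t j))
    (hle : ∀ v ∈ P, (T.card : ℤ) - (killed H M t T v).card ≤ excess F M P B v)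
    (hsum : (T.card : ℤ) - 2 ≤
      ∑ v ∈ P, (((T.erase b).card : ℤ) - (killed H M t (T.erase b) v).card))
    (hsingle : ∀ u ∈ P, u ≠ v → ∀ x ∈ M u, H.Adj (t b) x → ∀ a ∈ T, a ≠ b → ¬ H.Adj (t a) x)
    (hmax : ∀ a ∈ B, a ∉ T → ∀ y ∈ M a, (∀ i ∈ T, ¬ H.Adj (t i) y) →
      ∀ u ∈ P, ∀ x ∈ killed H M t T u, ¬ H.Adj y x)
    (hw : w ∈ P) (hwv : C w ≠ C v) :
    HasTransversal H M (P ∪ B) := by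
  classical
  have hex : ∀ u, ∃ x, u ∈ P → x ∈ M u ∧ H.Adj (t b) x := by
    intro u
    by_cases hu : u ∈ P
    · obtain ⟨x, hx⟩ := hnbr u hu b (hTB hbT) (t b) (ht b hbT)
      exact ⟨x, fun _ => hx⟩
    · exact ⟨t b, fun h => absurd h hu⟩
  choose x hx using hex
  set U := P.filter fun u => C u = C w with hU
  set T' := T.erase b with hT'
  have hUP : U ⊆ P := Finset.filter_subset _ _
  have hT'T : T' ⊆ T := Finset.erase_subset _ _
  have hwU : w ∈ U := Finset.mem_filter.2 ⟨hw, rfl⟩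
  set s : I → W := fun i => if i ∈ U then x i else t i with hs
  have hsU : ∀ i ∈ U, s i = x i := fun i hi => by simp [hs, hi]
  have hsT : ∀ i ∈ T', s i = t i := fun i hi => by
    have : i ∉ U := fun hi' => h.notMem_right (hUP hi') (hTB (hT'T hi))
    simp [hs, this]
  have hsM : ∀ i ∈ U ∪ T', s i ∈ M i := by
    intro i hi
    rcases Finset.mem_union.1 hi with hi | hi
    · rw [hsU i hi]; exact (hx i (hUP hi)).1
    · rw [hsT i hi]; exact ht i (hT'T hi)
  have hvU : ∀ u ∈ U, u ≠ v := fun u hu huv => hwv (huv ▸ (Finset.mem_filter.1 hu).2).symm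
  have hcross : ∀ i ∈ U, ∀ j ∈ T', ¬ H.Adj (t j) (x i) := fun i hi j hj =>
    hsingle i (hUP hi) (hvU i hi) _ (hx i (hUP hi)).1 (hx i (hUP hi)).2 j (hT'T hj)
      (Finset.ne_of_mem_erase hj)
  have hUind : ∀ i ∈ U, ∀ j ∈ U, ¬ F.Adj i j := by
    intro i hi j hj hF
    refine h.proper i (hUP hi) j (hUP hj) hF ?_
    rw [(Finset.mem_filter.1 hi).2, (Finset.mem_filter.1 hj).2]
  have hsind : ∀ i ∈ U ∪ T', ∀ j ∈ U ∪ T', i ≠ j → ¬ H.Adj (s i) (s j) := by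
    intro i hi j hj hij
    rcases Finset.mem_union.1 hi with hi | hi <;> rcases Finset.mem_union.1 hj with hj | hj
    · rw [hsU i hi, hsU j hj]
      exact h.no_edges i (hUP hi) j (hUP hj) hij (hUind i hi j hj) _ (hx i (hUP hi)).1 _
        (hx j (hUP hj)).1
    · rw [hsU i hi, hsT j hj]
      exact fun e => hcross i hi j hj e.symm
    · rw [hsU j hj, hsT i hi]
      exact hcross j hj i hi
    · rw [hsT i hi, hsT j hj]
      exact hind i (hT'T hi) j (hT'T hj) hij
  have hT'B : T' ⊆ B := hT'T.trans hTB
  have hcT' : T'.card + 1 = T.card := Finset.card_erase_add_one hbT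
  have hcB : (B \ T').card + T'.card = B.card := Finset.card_sdiff_add_card_eq_card hT'B
  have hcU : (P \ U).card + U.card = P.card := Finset.card_sdiff_add_card_eq_card hUP
  have hUpos : 0 < U.card := Finset.card_pos.2 ⟨w, hwU⟩
  have hcC : ((P \ U).image C).card + 1 ≤ (P.image C).card := by
    rw [Nat.succ_le_iff]
    refine Finset.card_lt_card ((Finset.ssubset_iff_of_subset
      (Finset.image_subset_image Finset.sdiff_subset)).2 ⟨C w, Finset.mem_image_of_mem C hw, ?_⟩)
    intro hmem
    obtain ⟨u, hu, huw⟩ := Finset.mem_image.1 hmem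
    rw [Finset.mem_sdiff] at hu
    exact hu.2 (Finset.mem_filter.2 ⟨hu.1, huw⟩)
  have key := h.sdiff (s := s) (U := U) (T := T') (fun a ha => ?_) ?_
  · have := HasTransversal.extend hsM hsind (IH _ _ _ (by omega) key)
    refine (?_ : U ∪ T' ∪ (P \ U ∪ B \ T') = P ∪ B) ▸ this
    rw [Finset.union_union_union_comm, Finset.union_sdiff_of_subset hUP,
      Finset.union_sdiff_of_subset hT'B]
  · rw [Finset.mem_sdiff] at ha
    have h1 := h.large a ha.1
    have haP : a ∉ U := fun hi => h.notMem_right (hUP hi) ha.1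
    -- A loss of `|T| = |T'| + 1` is affordable: `|B|` drops by `|T'|` and one class color
    -- disappears.
    have h2 : (killed H M s (U ∪ T') a).card ≤ T.card := by
      by_cases hab : a = b
      · subst hab
        -- All colors on `U` are matched to `t b`, so in the list of `b` they kill nothing else.
        have hsub : killed H M s (U ∪ T') a ⊆ insert (t a) (killed H M t T' a) := by
          intro y hy
          obtain ⟨hy, i, hi, hiy⟩ := mem_killed.1 hy
          rcases Finset.mem_union.1 hi with hi | hi
          · rw [hsU i hi] at hiy
            have hxi := hx i (hUP hi)
            rw [h.matching i a (fun e => haP (e ▸ hi)) _ hxi.1 _ hy _ (ht a hbT) hiy hxi.2.symm]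
            exact Finset.mem_insert_self _ _
          · rw [hsT i hi] at hiy
            exact Finset.mem_insert_of_mem (mem_killed.2 ⟨hy, i, hi, hiy⟩)
        have h3 := card_killed_le h.matching (s := t) (Q := T') (j := a)
          (fun i hi => ht i (hT'T hi)) ha.2
        have h4 := (Finset.card_le_card hsub).trans (Finset.card_insert_le _ _)
        omega
      · have haT : a ∉ T := fun haT => ha.2 (Finset.mem_erase.2 ⟨hab, haT⟩)
        -- The colors on `U` are themselves killed by `t b`; by maximality of `T` their neighbors
        -- here are already killed by `T`.
        have hsub : killed H M s (U ∪ T') a ⊆ killed H M t T a := by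
          intro y hy
          obtain ⟨hy, i, hi, hiy⟩ := mem_killed.1 hy
          rcases Finset.mem_union.1 hi with hi | hi
          · rw [hsU i hi] at hiy
            have hxi := hx i (hUP hi)
            by_contra hcon
            refine hmax a ha.1 haT y hy (fun j hj hjy => hcon (mem_killed.2 ⟨hy, j, hj, hjy⟩))
              i (hUP hi) (x i) (mem_killed.2 ⟨hxi.1, b, hbT, hxi.2⟩) hiy.symm
          · rw [hsT i hi] at hiy
            exact mem_killed.2 ⟨hy, i, hT'T hi, hiy⟩
        exact (Finset.card_le_card hsub).trans (card_killed_le h.matching ht haT)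
    omega
  · have hbound : ∀ u ∈ P, (T'.card : ℤ) - (killed H M t T' u).card ≤ excess F M P B u := by
      intro u hu
      refine le_trans ?_ (hle u hu)
      have := card_killed_insert_le h.matching (s := t) (Q := T') (ht b hbT)
        (fun e : u = b => h.notMem_right hu (hTB (e ▸ hbT)))
      rw [hT', Finset.insert_erase hbT, ← hT'] at this
      omega
    have hstep : ∀ u ∈ P \ U,
        cost k (excess F (fun j => M j \ killed H M s (U ∪ T') j) (P \ U) (B \ T') u) ≤
          excess F M P B u + k - (T'.card - (killed H M t T' u).card) := by
      intro u hu
      rw [Finset.mem_sdiff] at hu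
      have h0 := hbound u hu.1
      have h1 : (killed H M s (U ∪ T') u).card ≤
          (killed H M s U u).card + (killed H M s T' u).card :=
        (Finset.card_le_card killed_union_subset).trans (Finset.card_union_le _ _)
      rw [killed_congr hsT] at h1
      -- Kills by `U` come from neighbors of `u` in `U`, so the drop in degree pays for them.
      have h2 : (killed H M s U u).card ≤ (U.filter (F.Adj u)).card := by
        have hsub : killed H M s U u ⊆ killed H M s (U.filter (F.Adj u)) u := by
          intro y hy
          obtain ⟨hy, i, hi, hiy⟩ := mem_killed.1 hy
          refine mem_killed.2 ⟨hy, i, Finset.mem_filter.2 ⟨hi, ?_⟩, hiy⟩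
          by_contra hF
          exact h.no_edges i (hUP hi) u hu.1 (fun e => hu.2 (e ▸ hi)) (fun e => hF e.symm) _
            (hsM i (Finset.mem_union_left _ hi)) _ hy hiy
        refine (Finset.card_le_card hsub).trans (card_killed_le h.matching (fun i hi => ?_) ?_)
        · exact hsM i (Finset.mem_union_left _ (Finset.mem_filter.1 hi).1)
        · exact fun e => hu.2 (Finset.mem_filter.1 e).1
      have h3 : ((P \ U).filter (F.Adj u)).card + (U.filter (F.Adj u)).card =
          (P.filter (F.Adj u)).card := by
        rw [← Finset.card_union_of_disjoint, ← Finset.filter_union,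
          Finset.sdiff_union_of_subset hUP]
        exact Finset.disjoint_filter_filter Finset.sdiff_disjoint
      have h4 : ((M u \ killed H M s (U ∪ T') u).card : ℤ) =
          (M u).card - (killed H M s (U ∪ T') u).card := by
        rw [Finset.card_sdiff_of_subset killed_subset,
          Nat.cast_sub (Finset.card_le_card killed_subset)]
      refine (cost_mono k (b := excess F M P B u - (T'.card - (killed H M t T' u).card)) ?_).trans
        ?_
      · simp only [excess]
        rw [h4]
        omega
      · rw [cost_of_nonneg _ (by omega)]
        omega
    refine (Finset.sum_le_sum hstep).trans ?_
    have hsplit := Finset.sum_sdiff (f := fun u => excess F M P B u + k -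
      ((T'.card : ℤ) - (killed H M t T' u).card)) hUP
    -- The class removes at least the term of `w`, which is at least `k`. This offsets savings on
    -- `T'` that may sum to only `|T'| - 1`.
    have hUsum : 1 ≤ ∑ u ∈ U, (excess F M P B u + k -
        ((T'.card : ℤ) - (killed H M t T' u).card)) := by
      refine le_trans ?_ (Finset.single_le_sum (fun u hu => ?_) hwU)
      · have := hbound w hw; omega
      · have := hbound u (hUP hu); omega
    have htot := h.cost_le
    rw [Finset.sum_congr rfl fun v hv => cost_of_nonneg k (hexc v hv)] at htot
    have hP : ∑ u ∈ P, (excess F M P B u + k - ((T'.card : ℤ) - (killed H M t T' u).card)) =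
      ∑ u ∈ P, (excess F M P B u + k) - ∑ u ∈ P, ((T'.card : ℤ) - (killed H M t T' u).card) :=
      Finset.sum_sub_distrib _ _
    omega

end IsAdmissible
end

/-! ### Growing a compressed partial coloring -/

/-- A partial coloring `t` of `T ⊆ B` that kills few colors in the lists on `P`, where moreover the
color of `b` shares neighbors with the other colors only in the list of `v`. -/
structure IsCompressed {I W : Type*} [DecidableEq I] (F : SimpleGraph I) (H : SimpleGraph W)
    (P B : Finset I) (M : I → Finset W) (T : Finset I) (t : I → W) (b v : I) : Prop where
  subset : T ⊆ B
  mem_left : v ∈ P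
  mem : b ∈ T
  colors : ∀ a ∈ T, t a ∈ M a
  indep : ∀ i ∈ T, ∀ j ∈ T, i ≠ j → ¬ H.Adj (t i) (t j)
  le : ∀ u ∈ P, (T.card : ℤ) - (killed H M t T u).card ≤ excess F M P B u
  sum_ge : (T.card : ℤ) - 1 ≤ ∑ u ∈ P, ((T.card : ℤ) - (killed H M t T u).card)
  sum_erase_ge : (T.card : ℤ) - 2 ≤
    ∑ u ∈ P, (((T.erase b).card : ℤ) - (killed H M t (T.erase b) u).card)
  single : ∀ u ∈ P, u ≠ v → ∀ x ∈ M u, H.Adj (t b) x → ∀ a ∈ T, a ≠ b → ¬ H.Adj (t a) x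

section
variable {I W : Type*}
-- The list of `v` is at least as long as one on `B`, since the latter is matched into it, and so
-- longer than `|B|`. Nonnegative excess then forces positive degree in `P`.
theorem IsAdmissible.exists_adj [DecidableEq I] {F : SimpleGraph I} {H : SimpleGraph W}
    {C : I → ℕ} {k : ℕ} {P B : Finset I} {M : I → Finset W} (h : IsAdmissible F H C k P B M)
    (hexc : ∀ v ∈ P, 0 ≤ excess F M P B v)
    (hnbr : ∀ u ∈ P, ∀ a ∈ B, ∀ y ∈ M a, ∃ x ∈ M u, H.Adj y x) (hB : B.Nonempty) {v : I}
    (hv : v ∈ P) : ∃ w ∈ P, F.Adj v w := by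
  classical
  obtain ⟨a, ha⟩ := hB
  have hva : v ≠ a := fun e => h.notMem_right hv (e ▸ ha)
  have hle : (M a).card ≤ (M v).card := by
    choose! f hf hadj using hnbr v hv a ha
    refine Finset.card_le_card_of_injOn f hf fun y hy z hz hyz => ?_
    exact h.matching v a hva _ (hf y hy) y hy z hz (hadj y hy).symm (hyz ▸ (hadj z hz).symm)
  have h1 := h.large a ha
  have h2 : 0 < (P.image C).card := Finset.card_pos.2 ⟨_, Finset.mem_image_of_mem C hv⟩
  have h3 := hexc v hv
  simp only [excess] at h3
  obtain ⟨w, hw⟩ := Finset.card_pos.1 (show 0 < (P.filter (F.Adj v)).card by omega)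
  exact ⟨w, Finset.mem_filter.1 hw⟩

namespace IsAdmissible
variable [DecidableEq I] [DecidableEq W] {F : SimpleGraph I} {H : SimpleGraph W} {C : I → ℕ}
  {k : ℕ} {P B : Finset I} {M : I → Finset W}

/-- The new color meets an old kill in the list of `u`, so the saving there grows by one and the
deficit stays at most one. Whatever would break compression makes a reduction possible. -/
theorem extend_compressed (h : IsAdmissible F H C k P B M)
    (IH : ∀ P' B' M', P'.card + B'.card < P.card + B.card → IsAdmissible F H C k P' B' M' →
      HasTransversal H M' (P' ∪ B'))
    (hk : 2 ≤ k) (hexc : ∀ v ∈ P, 0 ≤ excess F M P B v)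
    {t : I → W} {T : Finset I} {b v : I} (hT : IsCompressed F H P B M T t b v)
    {a : I} (ha : a ∈ B) (haT : a ∉ T) {y : W} (hy : y ∈ M a) (hyT : ∀ i ∈ T, ¬ H.Adj (t i) y)
    {u : I} (hu : u ∈ P) {x : W} (hx : x ∈ killed H M t T u) (hyx : H.Adj y x) :
    HasTransversal H M (P ∪ B) ∨
      IsCompressed F H P B M (insert a T) (Function.update t a y) a u := by
  classical
  set r := Function.update t a y with hr
  have hra : r a = y := by simp [hr]
  have hrT : ∀ i ∈ T, r i = t i := fun i hi => by
    have : i ≠ a := fun e => haT (e ▸ hi)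
    simp [hr, this]
  have hkT : ∀ j, killed H M r T j = killed H M t T j := fun j => killed_congr hrT
  have hraM : r a ∈ M a := hra ▸ hy
  have hPa : ∀ {j}, j ∈ P → j ≠ a := fun hj e => h.notMem_right hj (e ▸ ha)
  have hsub : insert a T ⊆ B := Finset.insert_subset ha hT.subset
  have hne : (insert a T).Nonempty := ⟨a, Finset.mem_insert_self _ _⟩
  have hcol : ∀ i ∈ insert a T, r i ∈ M i := by
    intro i hi
    rcases Finset.mem_insert.1 hi with rfl | hi
    · exact hraM
    · rw [hrT i hi]; exact hT.colors i hi
  have hind : ∀ i ∈ insert a T, ∀ j ∈ insert a T, i ≠ j → ¬ H.Adj (r i) (r j) := by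
    intro i hi j hj hij
    rcases Finset.mem_insert.1 hi with hi | hiT <;> rcases Finset.mem_insert.1 hj with hj | hjT
    · exact absurd (hi.trans hj.symm) hij
    · rw [hi, hra, hrT j hjT]; exact fun e => hyT j hjT e.symm
    · rw [hj, hra, hrT i hiT]; exact hyT i hiT
    · rw [hrT i hiT, hrT j hjT]; exact hT.indep i hiT j hjT hij
  have hcard : (insert a T).card = T.card + 1 := Finset.card_insert_of_notMem haT
  have hmono : ∀ j ∈ P, (T.card : ℤ) - (killed H M t T j).card ≤
      (insert a T).card - (killed H M r (insert a T) j).card := by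
    intro j hj
    have := card_killed_insert_le h.matching (s := r) (Q := T) hraM (hPa hj)
    rw [hkT] at this
    omega
  have hstrict : ∀ j ∈ P, ∀ z ∈ killed H M t T j, H.Adj y z →
      (T.card : ℤ) - (killed H M t T j).card <
        (insert a T).card - (killed H M r (insert a T) j).card := by
    intro j hj z hz hyz
    rw [killed_insert_eq h.matching hraM (hPa hj) (x := z) (by rwa [hkT]) (by rwa [hra]), hkT]
    omega
  have hle : ∀ j ∈ P, ((insert a T).card : ℤ) - (killed H M r (insert a T) j).card ≤
      excess F M P B j + 1 := by
    intro j hj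
    have h1 := hT.le j hj
    have h2 := Finset.card_le_card
      (killed_mono (H := H) (M := M) (s := r) (j := j) (Finset.subset_insert a T))
    rw [hkT] at h2
    omega
  have hsum : ((insert a T).card : ℤ) - 1 ≤
      ∑ j ∈ P, (((insert a T).card : ℤ) - (killed H M r (insert a T) j).card) := by
    have h1 := Finset.sum_lt_sum hmono ⟨u, hu, hstrict u hu x hx hyx⟩
    have h2 := hT.sum_ge
    omega
  by_cases hover : ∃ j ∈ P, excess F M P B j <
      ((insert a T).card : ℤ) - (killed H M r (insert a T) j).card
  · obtain ⟨j, hj, hjo⟩ := hover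
    exact Or.inl (h.color_right_of_overflow IH hk hexc hsub hne hcol hind hle hsum hj hjo)
  by_cases htwo : ∃ j ∈ P, j ≠ u ∧ ∃ z ∈ killed H M t T j, H.Adj y z
  · obtain ⟨j, hj, hju, z, hz, hyz⟩ := htwo
    refine Or.inl (h.color_right_of_collisions IH (by omega) hexc hsub hne hcol hind hle ?_)
    -- Two lists gain a unit each: `(|T| - 1) + 2 = |insert a T|`.
    have h1 := Finset.sum_lt_sum (fun i hi => hmono i (Finset.mem_of_mem_erase hi))
      ⟨j, Finset.mem_erase.2 ⟨hju, hj⟩, hstrict j hj z hz hyz⟩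
    have h2 := hstrict u hu x hx hyx
    have h3 := hT.sum_ge
    rw [← Finset.add_sum_erase P _ hu] at h3 ⊢
    omega
  push Not at hover htwo
  refine Or.inr ⟨hsub, hu, Finset.mem_insert_self _ _, hcol, hind, hover, hsum, ?_, ?_⟩
  · rw [Finset.erase_insert haT]
    simp only [hkT]
    have := hT.sum_ge
    omega
  · intro j hj hju z hz hyz i hi hia hiz
    have hiT : i ∈ T := (Finset.mem_insert.1 hi).resolve_left hia
    rw [hra] at hyz
    rw [hrT i hiT] at hiz
    exact htwo j hj hju z (mem_killed.2 ⟨hz, i, hiT, hiz⟩) hyz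

/-- If every color of the complete part has a neighbor in every other list, then some vertex of the
complete part can be colored first, and this coloring can be extended until it is stuck. -/
theorem exists_maximal_compressed (h : IsAdmissible F H C k P B M)
    (IH : ∀ P' B' M', P'.card + B'.card < P.card + B.card → IsAdmissible F H C k P' B' M' →
      HasTransversal H M' (P' ∪ B'))
    (hk : 2 ≤ k) (hexc : ∀ v ∈ P, 0 ≤ excess F M P B v)
    (hnbr : ∀ u ∈ P, ∀ a ∈ B, ∀ y ∈ M a, ∃ x ∈ M u, H.Adj y x)
    (hP : P.Nonempty) (hB : B.Nonempty) (hnot : ¬ HasTransversal H M (P ∪ B)) :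
    ∃ T t b v, IsCompressed F H P B M T t b v ∧
      ∀ a ∈ B, a ∉ T → ∀ y ∈ M a, (∀ i ∈ T, ¬ H.Adj (t i) y) →
        ∀ u ∈ P, ∀ x ∈ killed H M t T u, ¬ H.Adj y x := by
  classical
  let Q : ℕ → Prop := fun n => ∃ T t b v, IsCompressed F H P B M T t b v ∧ T.card = n
  have hQ1 : Q 1 := by
    obtain ⟨v, hv⟩ := hP
    obtain ⟨b, hb⟩ := hB
    have hpos : 0 < B.card := Finset.card_pos.2 ⟨b, hb⟩
    have h1 := h.large b hb
    obtain ⟨y, hy⟩ : (M b).Nonempty := Finset.card_pos.1 (by omega)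
    -- All savings of a single vertex vanish, and there are no other colors to collide with, so `v`
    -- is arbitrary.
    have hle : ∀ u ∈ P, (killed H M (fun _ => y) {b} u).card = 1 := by
      intro u hu
      refine le_antisymm ?_ (Finset.card_pos.2 ?_)
      · refine (card_killed_le h.matching (by simpa using hy) ?_).trans (by simp)
        simpa using fun e : u = b => h.notMem_right hu (e ▸ hb)
      · obtain ⟨x, hx, hyx⟩ := hnbr u hu b hb y hy
        exact ⟨x, mem_killed.2 ⟨hx, b, by simp, hyx⟩⟩
    refine ⟨{b}, fun _ => y, b, v, ⟨by simpa using hb, hv, by simp, by simpa using hy, by simp,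
      fun u hu => ?_, ?_, ?_, by simp⟩, by simp⟩
    · simpa [hle u hu] using hexc u hu
    · rw [Finset.sum_congr rfl fun u hu => by rw [hle u hu]]
      simp
    · have : ∀ u, killed H M (fun _ => y) ∅ u = ∅ := fun u => by
        ext x; simp [mem_killed]
      simp [this]
  have hbound : ∀ n, Q n → n ≤ B.card := by
    rintro n ⟨T, t, b, v, hT, rfl⟩
    exact Finset.card_le_card hT.subset
  obtain ⟨T, t, b, v, hT, hcard⟩ := Nat.findGreatest_spec (hbound 1 hQ1) hQ1
  refine ⟨T, t, b, v, hT, fun a ha haT y hy hyT u hu x hx hyx => ?_⟩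
  rcases h.extend_compressed IH hk hexc hT ha haT hy hyT hu hx hyx with h' | h'
  · exact hnot h'
  · have hQ' : Q (insert a T).card := ⟨_, _, _, _, h', rfl⟩
    have h1 := Nat.le_findGreatest (hbound _ hQ') hQ'
    rw [← hcard, Finset.card_insert_of_notMem haT] at h1
    omega

/-- Reduction by coloring a vertex of the complete part with a color that kills nothing in the list
of `u`. -/
theorem color_of_no_neighbor (h : IsAdmissible F H C k P B M)
    (IH : ∀ P' B' M', P'.card + B'.card < P.card + B.card → IsAdmissible F H C k P' B' M' →
      HasTransversal H M' (P' ∪ B'))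
    (hk : 1 ≤ k) (hexc : ∀ v ∈ P, 0 ≤ excess F M P B v)
    {u a : I} (hu : u ∈ P) (ha : a ∈ B) {y : W} (hy : y ∈ M a) (hyu : ∀ x ∈ M u, ¬ H.Adj y x) :
    HasTransversal H M (P ∪ B) := by
  have hle : ∀ v ∈ P, (killed H M (fun _ => y) {a} v).card ≤ 1 := fun v hv => by
    refine (card_killed_le h.matching (by simpa using hy) ?_).trans (by simp)
    simpa using fun e : v = a => h.notMem_right hv (e ▸ ha)
  refine h.color_right_of_collisions IH hk hexc (s := fun _ => y) (T := {a}) (by simpa using ha)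
    (by simp) (by simpa using hy) (by simp) (fun v hv => ?_) ?_
  · have := hexc v hv
    simp only [Finset.card_singleton]
    omega
  · refine le_trans ?_ (Finset.single_le_sum (fun v hv => ?_) hu)
    · have : killed H M (fun _ => y) {a} u = ∅ := by
        ext x
        simpa [mem_killed] using hyu x
      simp [this]
    · have := hle v hv
      simp only [Finset.card_singleton]
      omega

/-- The bound `k` in the cost stays fixed through the induction, while the lists on `B` are measured
against the class colors still present on `P`. -/
theorem hasTransversal [Nonempty W] (h : IsAdmissible F H C k P B M) :
    HasTransversal H M (P ∪ B) := by
  classical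
  induction hn : P.card + B.card using Nat.strong_induction_on generalizing P B M with
  | _ n ih =>
  have IH : ∀ P' B' M', P'.card + B'.card < P.card + B.card → IsAdmissible F H C k P' B' M' →
      HasTransversal H M' (P' ∪ B') := fun P' B' M' hlt h' => ih _ (hn ▸ hlt) h' rfl
  rcases P.eq_empty_or_nonempty with rfl | hP
  · exact h.of_left_empty IH inferInstance
  by_contra hnot
  have hexc : ∀ v ∈ P, 0 ≤ excess F M P B v := fun v hv => by
    by_contra hneg
    exact hnot (h.delete_left IH hv (by omega))
  have hk : 1 ≤ k := (Finset.card_pos.2 (hP.image C)).trans_le h.colors_le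
  have hnbr : ∀ u ∈ P, ∀ a ∈ B, ∀ y ∈ M a, ∃ x ∈ M u, H.Adj y x := by
    intro u hu a ha y hy
    by_contra! hcon
    exact hnot (h.color_of_no_neighbor IH hk hexc hu ha hy hcon)
  obtain ⟨v₀, hv₀⟩ := hP
  have hB : B.Nonempty := by
    rw [← Finset.card_pos]
    have h1 := h.cost_le
    have h2 := Finset.single_le_sum (fun v _ => cost_nonneg k (excess F M P B v)) hv₀
    rw [cost_of_nonneg k (hexc v₀ hv₀)] at h2
    have := hexc v₀ hv₀
    omega
  have hk2 : 2 ≤ k := by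
    obtain ⟨w, hw, hvw⟩ := h.exists_adj hexc hnbr hB hv₀
    refine le_trans ?_ h.colors_le
    exact Finset.one_lt_card.2 ⟨_, Finset.mem_image_of_mem C hv₀, _, Finset.mem_image_of_mem C hw,
      h.proper _ hv₀ _ hw hvw⟩
  obtain ⟨T, t, b, v, hT, hmax⟩ :=
    h.exists_maximal_compressed IH hk2 hexc hnbr ⟨v₀, hv₀⟩ hB hnot
  obtain ⟨w, hw, hvw⟩ := h.exists_adj hexc hnbr hB hT.mem_left
  exact hnot (h.color_class IH hk hexc hnbr hT.subset hT.mem hT.colors hT.indep hT.le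
    hT.sum_erase_ge hT.single hmax hw (h.proper _ hT.mem_left _ hw hvw).symm)

end IsAdmissible
end

/-! ### From covers to admissible problems and back -/

theorem cost_le_max (k : ℕ) (e : ℤ) : (cost k e : ℝ) ≤ max ((e : ℝ) + k) 0 := by
  unfold cost
  split_ifs <;> simp

theorem isAdmissible_of_isDPCover {V α W : Type*} [Fintype V] [Fintype α] [DecidableEq V]
    [DecidableEq α] {G : SimpleGraph V} [DecidableRel G.Adj] {k n : ℕ} (hn : n ≤ k)
    (col : G.Coloring (Fin n)) {L : V ⊕ α → Finset W} {H : SimpleGraph W}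
    (hcover : IsDPCover (graphJoin G (⊤ : SimpleGraph α)) L H)
    (hA : ∀ a : α, Fintype.card α + n ≤ (L (Sum.inr a)).card)
    (hsum : ∑ v : V, max ((G.degree v : ℝ) - ((L (Sum.inl v)).card : ℝ) + (Fintype.card α : ℝ) +
      (k : ℝ)) 0 ≤ Fintype.card α) :
    IsAdmissible (graphJoin G (⊤ : SimpleGraph α)) H (Sum.elim (fun v => (col v : ℕ)) fun _ => 0) k
      (Finset.univ.map Function.Embedding.inl) (Finset.univ.map Function.Embedding.inr) L := by
  classical
  have hcol : ((Finset.univ.map (Function.Embedding.inl : V ↪ V ⊕ α)).image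
      (Sum.elim (fun v => (col v : ℕ)) fun _ => 0)).card ≤ n := by
    refine (Finset.card_le_card (t := Finset.range n) fun i hi => ?_).trans (by simp)
    simp only [Finset.mem_image, Finset.mem_map, Finset.mem_univ, true_and] at hi
    obtain ⟨_, ⟨v, rfl⟩, rfl⟩ := hi
    simp
  refine ⟨?_, fun i j hij x hx y hy z hz hxy hxz => ?_, ?_, ?_, hcol.trans hn, ?_, ?_⟩
  · simp [Finset.disjoint_left]
  · by_cases hadj : (graphJoin G (⊤ : SimpleGraph α)).Adj i j
    · exact hcover.matching i j hadj x hx y hy z hz hxy hxz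
    · exact absurd hxy (hcover.no_edges i j hij hadj x hx y hy)
  · exact fun u _ v _ => hcover.no_edges u v
  · simp only [Finset.mem_map, Finset.mem_univ, true_and]
    rintro _ ⟨u, rfl⟩ _ ⟨v, rfl⟩ hadj
    have : G.Adj u v := by simpa [graphJoin] using hadj
    simpa [Fin.val_inj] using col.valid this
  · simp only [Finset.mem_map, Finset.mem_univ, true_and]
    rintro _ ⟨a, rfl⟩
    have := hA a
    simp only [Finset.card_map, Finset.card_univ, Function.Embedding.inr_apply]
    omega
  · have hdeg : ∀ v : V, ((Finset.univ.map (Function.Embedding.inl : V ↪ V ⊕ α)).filter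
        ((graphJoin G (⊤ : SimpleGraph α)).Adj (Sum.inl v))).card = G.degree v := by
      intro v
      rw [Finset.filter_map, Finset.card_map, ← G.card_neighborFinset_eq_degree]
      congr 1
      ext u
      rw [Finset.mem_filter, SimpleGraph.mem_neighborFinset]
      simp [graphJoin]
    rw [Finset.sum_map, ← Int.cast_le (R := ℝ)]
    simp only [Int.cast_sum, Finset.card_map, Finset.card_univ, Int.cast_natCast]
    refine le_trans (Finset.sum_le_sum fun v _ => (cost_le_max _ _).trans (le_of_eq ?_)) hsum
    congr 2
    simp only [excess, Function.Embedding.inl_apply, Finset.card_map, Finset.card_univ]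
    rw [hdeg]
    push_cast
    ring

theorem HasTransversal.isDPColorable {I W : Type*} [Fintype I] {F : SimpleGraph I}
    {L : I → Finset W} {H : SimpleGraph W} (hcover : IsDPCover F L H)
    (h : HasTransversal H L Finset.univ) : IsDPColorable I H := by
  classical
  obtain ⟨s, hs, hind⟩ := h
  have hinj : Function.Injective s := fun i j hij =>
    (hcover.partition (s i)).unique (hs i (Finset.mem_univ i)) (hij ▸ hs j (Finset.mem_univ j))
  refine ⟨Finset.univ.image s, ?_, ?_⟩
  · intro x hx y hy hxy
    simp only [Finset.coe_image, Finset.coe_univ, Set.image_univ, Set.mem_range] at hx hy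
    obtain ⟨i, rfl⟩ := hx
    obtain ⟨j, rfl⟩ := hy
    exact hind i (Finset.mem_univ i) j (Finset.mem_univ j) fun e => hxy (congrArg s e)
  · rw [Finset.card_image_of_injective _ hinj, Finset.card_univ]

theorem theorem1p5 {V α W : Type*} [Fintype V] [Fintype α]
    (G : SimpleGraph V) [DecidableRel G.Adj] (k : ℕ) (hk : G.Colorable k)
    (L : V ⊕ α → Finset W) (H : SimpleGraph W)
    (hcover : IsDPCover (graphJoin G (⊤ : SimpleGraph α)) L H)
    (hA : ∀ a : α, (Fintype.card α : ℕ∞) + G.chromaticNumber ≤ ((L (Sum.inr a)).card : ℕ∞))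
    (hsum : (Fintype.card α : ℝ) ≥ 2 * ((k : ℝ) + 1) / (2 * (k : ℝ) + 1) *
      ∑ v : V, max ((G.degree v : ℝ) - ((L (Sum.inl v)).card : ℝ) + (Fintype.card α : ℝ) + (k : ℝ)) 0) :
    IsDPColorable (V ⊕ α) H := by
  classical
  have hχ : G.chromaticNumber ≤ k := SimpleGraph.chromaticNumber_le_iff_colorable.2 hk
  obtain ⟨n, hn⟩ := ENat.ne_top_iff_exists.1 (ne_top_of_le_ne_top (ENat.natCast_ne_top k) hχ)
  rw [← hn] at hχ hA
  obtain ⟨col⟩ : G.Colorable n := SimpleGraph.chromaticNumber_le_iff_colorable.1 hn.ge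
  have hS : ∑ v : V, max ((G.degree v : ℝ) - ((L (Sum.inl v)).card : ℝ) + (Fintype.card α : ℝ) +
      (k : ℝ)) 0 ≤ Fintype.card α := by
    refine le_trans (le_mul_of_one_le_left (Finset.sum_nonneg fun _ _ => le_max_right _ _) ?_) hsum
    rw [one_le_div (by positivity)]
    linarith
  have hA' : ∀ a : α, Fintype.card α + n ≤ (L (Sum.inr a)).card := fun a => by
    exact_mod_cast hA a
  have hadm := isAdmissible_of_isDPCover (by exact_mod_cast hχ) col hcover hA' hS
  have huniv : Finset.univ.map (Function.Embedding.inl : V ↪ V ⊕ α) ∪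
      Finset.univ.map Function.Embedding.inr = Finset.univ := by
    ext i
    cases i <;> simp
  refine HasTransversal.isDPColorable hcover (huniv ▸ ?_)
  -- A transversal is a total function into `W`. If `W` is empty, the empty lists force both `α` and
  -- `V` to be empty.
  rcases isEmpty_or_nonempty W with hW | hW
  · have hL : ∀ i, (L i).card = 0 := fun i => by simp [Finset.eq_empty_of_isEmpty (L i)]
    have hα : IsEmpty α := ⟨fun a => by
      have h1 := hA' a
      have h2 : 0 < Fintype.card α := Fintype.card_pos_iff.2 ⟨a⟩
      rw [hL] at h1
      omega⟩
    have hV : IsEmpty V := ⟨fun v => by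
      have h1 : (0 : ℝ) < k := by
        exact_mod_cast (Nat.zero_le _).trans_lt ((col v).isLt.trans_le (by exact_mod_cast hχ))
      have h2 := (Finset.single_le_sum (fun _ _ => le_max_right _ _) (Finset.mem_univ v)).trans hS
      have h3 := (le_max_left _ _).trans h2
      simp only [hL, Fintype.card_eq_zero, Nat.cast_zero] at h3
      have h4 : (0 : ℝ) ≤ G.degree v := Nat.cast_nonneg _
      linarith⟩
    exact ⟨isEmptyElim, fun i => isEmptyElim i, fun i => isEmptyElim i⟩
  · exact hadm.hasTransversal
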